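/- Conventions. Let $T=(T,\eta^T,\mu^T)$ and $S=(S,\eta^S,\mu^S)$ be monads and $G$ an endofunctor on a category $\mathcal C$. A weak distributive law of $T$ over the monad $S$ is a natural transformation $\lambda: TS\Rightarrow ST$ with $\lambda\circ\mu^T S = S\mu^T\circ\lambda T\circ T\lambda$, $\lambda\circ T\mu^S=\mu^S T\circ S\lambda\circ\lambda S$ and $\lambda\circ T\eta^S=\eta^S T$. A weak distributive law of $T$ over the endofunctor $G$ is a natural transformation $\sigma: TG\Rightarrow GT$ with $\sigma\circ\mu^T G=G\mu^T\circ\sigma T\circ T\sigma$; it is strong if moreover $\sigma\circ\eta^T G=G\eta^T$. Let $F\dashv U$ be the Eilenberg–Moore adjunction of $T$, with counit $\varepsilon$. A weak lifting of $S$ on $T$ is a monad $\tilde S=(\tilde S,\tilde\eta,\tilde\mu)$ on the category of $T$-algebras together with natural transformations $\pi: SU\Rightarrow U\tilde S$ and $\iota: U\tilde S\Rightarrow SU$ such that $\pi\circ\iota=1$, $\iota\circ U\tilde\mu=\mu^S U\circ S\iota\circ\iota\tilde S$, $\pi\circ\mu^S U=U\tilde\mu\circ\pi\tilde S\circ S\pi$,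 $\iota\circ U\tilde\eta=\eta^S U$ and $\pi\circ\eta^S U=U\tilde\eta$. It corresponds to $\lambda: TS\Rightarrow ST$ if $\lambda=\iota F\circ U\varepsilon\tilde S F\circ T\pi F\circ TS\eta^T$. Its composite monad, written $\overline{ST}$, is the monad on $\mathcal C$ of the composite of the Eilenberg–Moore adjunctions of $T$ and of $\tilde S$; its functor is $U\tilde SF$. Put $\pi^*=\pi F: ST\Rightarrow\overline{ST}$ and $\iota^*=\iota F:\overline{ST}\Rightarrow ST$. Theorem. Let $T,S$ be monads on a category $\mathcal C$ in which idempotents split, and let $G$ be an endofunctor on $\mathcal C$. Let $\lambda: TS\Rightarrow ST$ be a weak distributive law of $T$ over the monad $S$, and let $\sigma: TG\Rightarrow GT$ and $\tau: SG\Rightarrow GS$ be weak distributive laws over the endofunctor $G$. Assume the Yang–Baxter condition $\tau T\circ S\sigma\circ\lambda G=G\lambda\circ\sigma S\circ T\tau$. Then there is a weak lifting of $S$ on $T$ corresponding to $\lambda$ and, for every such weak lifting, the composite $$G\pi^*\circ\tau T\circ S\sigma\circ\iota^*G:\ \overline{ST}\,G\Rightarrow G\,\overline{ST}$$ is a weak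 distributive law of the composite monad $\overline{ST}$ over $G$. If moreover $\sigma$ and $\tau$ are strong, then this composite law is strong. -/

import Mathlib

open CategoryTheory

universe v u

/-- A natural transformation `l : TS ⇒ ST` is a weak distributive law between the monads
`T` and `S` when it is compatible with both multiplications and with the unit of `S`
(no compatibility with the unit of `T` is required).
In diagrammatic order, `S ⋙ T` is the functor `X ↦ T (S X)`. -/
structure IsWeakDistributiveLaw {C : Type u} [Category.{v} C] (T S : Monad C)
    (l : S.toFunctor ⋙ T.toFunctor ⟶ T.toFunctor ⋙ S.toFunctor) : Prop where
  mu_left : ∀ X : C, T.μ.app (S.obj X) ≫ l.app X =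
    T.map (l.app X) ≫ l.app (T.obj X) ≫ S.map (T.μ.app X)
  mu_right : ∀ X : C, T.map (S.μ.app X) ≫ l.app X =
    l.app (S.obj X) ≫ S.map (l.app X) ≫ S.μ.app (T.obj X)
  eta_right : ∀ X : C, T.map (S.η.app X) ≫ l.app X = S.η.app (T.obj X)

/-- A natural transformation `l : TG ⇒ GT` is a weak distributive law of the monad `T` over
the endofunctor `G` when it is compatible with the multiplication of `T`. -/
structure IsWeakDistributiveLawOver {C : Type u} [Category.{v} C] (T : Monad C) (G : C ⥤ C)
    (l : G ⋙ T.toFunctor ⟶ T.toFunctor ⋙ G) : Prop where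
  mu : ∀ X : C, T.μ.app (G.obj X) ≫ l.app X =
    T.map (l.app X) ≫ l.app (T.obj X) ≫ G.map (T.μ.app X)

/-- A (strong) distributive law of the monad `T` over the endofunctor `G` is moreover compatible
with the unit of `T`. -/
structure IsDistributiveLawOver {C : Type u} [Category.{v} C] (T : Monad C) (G : C ⥤ C)
    (l : G ⋙ T.toFunctor ⟶ T.toFunctor ⋙ G) : Prop extends
    IsWeakDistributiveLawOver T G l where
  eta : ∀ X : C, T.η.app (G.obj X) ≫ l.app X = G.map (T.η.app X)

/-- A weak lifting of the monad `S` on the monad `T`: a monad on the Eilenberg–Moore category of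
`T`, together with `π : S U ⇒ U S'` and `ι : U S' ⇒ S U` (where `U` is the forgetful functor and
`S'` the lifted monad) such that `π ∘ ι = 1`, both compatible with units and multiplications. -/
structure WeakLifting {C : Type u} [Category.{v} C] (T S : Monad C) where
  /-- the lifted monad on the category of `T`-algebras -/
  lift : Monad T.Algebra
  /-- the projection `S U ⇒ U S'` -/
  π : T.forget ⋙ S.toFunctor ⟶ lift.toFunctor ⋙ T.forget
  /-- the inclusion `U S' ⇒ S U` -/
  ι : lift.toFunctor ⋙ T.forget ⟶ T.forget ⋙ S.toFunctor
  ι_π : ι ≫ π = 𝟙 (lift.toFunctor ⋙ T.forget)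
  ι_mu : ∀ A : T.Algebra, T.forget.map (lift.μ.app A) ≫ ι.app A =
    ι.app (lift.obj A) ≫ S.map (ι.app A) ≫ S.μ.app (T.forget.obj A)
  π_mu : ∀ A : T.Algebra, S.μ.app (T.forget.obj A) ≫ π.app A =
    S.map (π.app A) ≫ π.app (lift.obj A) ≫ T.forget.map (lift.μ.app A)
  ι_eta : ∀ A : T.Algebra, T.forget.map (lift.η.app A) ≫ ι.app A = S.η.app (T.forget.obj A)
  π_eta : ∀ A : T.Algebra, S.η.app (T.forget.obj A) ≫ π.app A = T.forget.map (lift.η.app A)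

namespace WeakLifting

variable {C : Type u} [Category.{v} C] {T S : Monad C} (W : WeakLifting T S)

/-- The component `S A ⟶ U (S' A)` of `π` at an algebra `A`. -/
def proj (A : T.Algebra) : S.obj A.A ⟶ (W.lift.obj A).A := W.π.app A

/-- The component `U (S' A) ⟶ S A` of `ι` at an algebra `A`. -/
def incl (A : T.Algebra) : (W.lift.obj A).A ⟶ S.obj A.A := W.ι.app A

theorem proj_naturality {A B : T.Algebra} (f : A ⟶ B) :
    S.map f.f ≫ W.proj B = W.proj A ≫ (W.lift.map f).f := W.π.naturality f

theorem incl_naturality {A B : T.Algebra} (f : A ⟶ B) :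
    (W.lift.map f).f ≫ W.incl B = W.incl A ≫ S.map f.f := W.ι.naturality f

/-- The composite monad `ST` on `C`: the monad of the composite of the Eilenberg–Moore adjunction
of `T` with the Eilenberg–Moore adjunction of the lifted monad. Its functor is `U S' F`. -/
def compositeMonad : Monad C := (T.adj.comp W.lift.adj).toMonad

/-- The natural transformation `π* = π F` from the functor `X ↦ S (T X)` to the composite monad. -/
def piStar : T.toFunctor ⋙ S.toFunctor ⟶ W.compositeMonad.toFunctor where
  app X := W.proj (T.free.obj X)
  naturality _ _ f := W.proj_naturality (T.free.map f)

/-- The natural transformation `ι* = ι F` from the composite monad to the functor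
`X ↦ S (T X)`. -/
def iotaStar : W.compositeMonad.toFunctor ⟶ T.toFunctor ⋙ S.toFunctor where
  app X := W.incl (T.free.obj X)
  naturality _ _ f := W.incl_naturality (T.free.map f)

/-- The natural transformation `TS ⇒ ST` corresponding to a weak lifting: the composite
`TS ⇒ TST ⇒ TUS'F ⇒ US'F ⇒ ST` of `T S η`, `T π F`, `U ε S' F` and `ι F`. Here `ε` is the counit
of the Eilenberg–Moore adjunction, so `U ε` is at each algebra its structure map. -/
def toLaw : S.toFunctor ⋙ T.toFunctor ⟶ T.toFunctor ⋙ S.toFunctor where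
  app X := T.map (S.map (T.η.app X)) ≫ T.map (W.proj (T.free.obj X)) ≫
    (W.lift.obj (T.free.obj X)).a ≫ W.incl (T.free.obj X)
  naturality X Y f := by
    have key : ∀ {A B : C} (a : T.obj A ⟶ A) (b : T.obj B ⟶ B) (p : S.obj (T.obj X) ⟶ A)
        (q : S.obj (T.obj Y) ⟶ B) (i : A ⟶ S.obj (T.obj X)) (j : B ⟶ S.obj (T.obj Y))
        (g : A ⟶ B), S.map (T.map f) ≫ q = p ≫ g → g ≫ j = i ≫ S.map (T.map f) →
        T.map g ≫ b = a ≫ g →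
        T.map (S.map f) ≫ T.map (S.map (T.η.app Y)) ≫ T.map q ≫ b ≫ j =
          (T.map (S.map (T.η.app X)) ≫ T.map p ≫ a ≫ i) ≫ S.map (T.map f) := by
      intro A B a b p q i j g h1 h2 h3
      have h4 : f ≫ T.η.app Y = T.η.app X ≫ T.map f := T.η.naturality f
      simp only [Category.assoc]
      rw [← h2, ← reassoc_of% h3]
      simp only [← Functor.map_comp_assoc]
      rw [h4, ← h1, S.map_comp, Category.assoc]
    exact key _ _ _ _ _ _ _ (W.proj_naturality (T.free.map f))
      (W.incl_naturality (T.free.map f)) (W.lift.map (T.free.map f)).h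

/-- For `σ : TG ⇒ GT` and `τ : SG ⇒ GS`, the composite of `ι* G`, `S σ`, `τ T` and `G π*`, from
the functor `X ↦ (ST) (G X)` to the functor `X ↦ G ((ST) X)`. -/
def compositeLaw {G : C ⥤ C} (σ : G ⋙ T.toFunctor ⟶ T.toFunctor ⋙ G)
    (τ : G ⋙ S.toFunctor ⟶ S.toFunctor ⋙ G) :
    G ⋙ W.compositeMonad.toFunctor ⟶ W.compositeMonad.toFunctor ⋙ G where
  app X := W.iotaStar.app (G.obj X) ≫ S.map (σ.app X) ≫ τ.app (T.obj X) ≫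
    G.map (W.piStar.app X)
  naturality X Y f := by
    have h1 := W.iotaStar.naturality (G.map f)
    have h2 := σ.naturality f
    have h3 := τ.naturality (T.map f)
    have h4 := W.piStar.naturality f
    simp only [Functor.comp_obj, Functor.comp_map] at h1 h2 h3 h4 ⊢
    rw [reassoc_of% h1, ← Functor.map_comp_assoc S.toFunctor (T.map (G.map f)), h2]
    simp only [Functor.map_comp, Category.assoc]
    rw [reassoc_of% h3, ← G.map_comp, h4, G.map_comp]

end WeakLifting

/-- The Yang–Baxter condition for `lam : TS ⇒ ST`, `σ : TG ⇒ GT` and `τ : SG ⇒ GS`: the two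
composites `TSG ⇒ STG ⇒ SGT ⇒ GST` and `TSG ⇒ TGS ⇒ GTS ⇒ GST` agree. -/
def YangBaxter {C : Type u} [Category.{v} C] {T S : Monad C} {G : C ⥤ C}
    (lam : S.toFunctor ⋙ T.toFunctor ⟶ T.toFunctor ⋙ S.toFunctor)
    (σ : G ⋙ T.toFunctor ⟶ T.toFunctor ⋙ G)
    (τ : G ⋙ S.toFunctor ⟶ S.toFunctor ⋙ G) : Prop :=
  ∀ X : C, lam.app (G.obj X) ≫ S.map (σ.app X) ≫ τ.app (T.obj X) =
    T.map (τ.app X) ≫ σ.app (S.obj X) ≫ G.map (lam.app X)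

/-! For a `T`-algebra `A`, the law gives `S A` an action `S a ∘ λ` of `T` that is associative but,
as `λ` may ignore the unit of `T`, perhaps not unital. The unit then acts by an idempotent; its
splitting is a genuine algebra, and these splittings carry the lifted monad (`weakLifting`). Since
the inclusions into `S A` are monic, naturality and the monad laws reduce to those of `S`.

For an arbitrary weak lifting corresponding to `λ`, put `m = μ^S T ∘ SSμ^T ∘ SλT : STST ⇒ ST`
(`preMult`). Both `ι*` and `π*` carry the multiplication of the composite monad to `m`
(`mu_iotaStar`, `piStar_mu`), and Yang–Baxter makes `τT ∘ Sσ` compatible with `m`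
(`preMult_compositeTransfer`). Pasting the three squares gives multiplicativity of the composite law
(`mu_of_transfer`). In the strong case the unit axiom follows from compatibility of `ι`, `π`, `σ`
and `τ` with units. -/

namespace IsWeakDistributiveLaw

/-! ### The non-unital action on `S A` and its idempotent -/

variable {C : Type u} [Category.{v} C] {T S : Monad C}
  {l : S.toFunctor ⋙ T.toFunctor ⟶ T.toFunctor ⋙ S.toFunctor}

/-- The action `T S A ⟶ S A` induced by `l` on a `T`-algebra `A`, in general not unital. -/
def action (l : S.toFunctor ⋙ T.toFunctor ⟶ T.toFunctor ⋙ S.toFunctor) (A : T.Algebra) :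
    T.obj (S.obj A.A) ⟶ S.obj A.A :=
  l.app A.A ≫ S.map A.a

/-- The endomorphism of `S A` by which the unit of `T` acts; it is idempotent when `l` is a weak
distributive law. -/
def idem (l : S.toFunctor ⋙ T.toFunctor ⟶ T.toFunctor ⋙ S.toFunctor) (A : T.Algebra) :
    S.obj A.A ⟶ S.obj A.A :=
  T.η.app (S.obj A.A) ≫ action l A

theorem law_naturality (l : S.toFunctor ⋙ T.toFunctor ⟶ T.toFunctor ⋙ S.toFunctor)
    {X Y : C} (f : X ⟶ Y) :
    T.map (S.map f) ≫ l.app Y = l.app X ≫ S.map (T.map f) :=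
  l.naturality f

theorem unit_naturality (T : Monad C) {X Y : C} (f : X ⟶ Y) :
    f ≫ T.η.app Y = T.η.app X ≫ T.map f :=
  T.η.naturality f

theorem mult_naturality (T : Monad C) {X Y : C} (f : X ⟶ Y) :
    T.map (T.map f) ≫ T.μ.app Y = T.μ.app X ≫ T.map f :=
  T.μ.naturality f

theorem action_naturality {A B : T.Algebra} (f : A ⟶ B) :
    T.map (S.map f.f) ≫ action l B = action l A ≫ S.map f.f := by
  have h := f.h
  simp only [action, Category.assoc, ← Functor.map_comp]
  rw [reassoc_of% law_naturality l f.f, ← Functor.map_comp, h]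

theorem idem_naturality {A B : T.Algebra} (f : A ⟶ B) :
    S.map f.f ≫ idem l B = idem l A ≫ S.map f.f := by
  simp only [idem, Category.assoc]
  rw [reassoc_of% unit_naturality T (S.map f.f), action_naturality f]

theorem mu_action (h : IsWeakDistributiveLaw T S l) (A : T.Algebra) :
    T.μ.app (S.obj A.A) ≫ action l A = T.map (action l A) ≫ action l A := by
  have h1 := h.mu_left A.A
  simp only [action, Functor.map_comp, Category.assoc]
  rw [reassoc_of% h1, ← Functor.map_comp, A.assoc, Functor.map_comp,
    reassoc_of% law_naturality l A.a]

/-- Associativity of the action combined with the left unit law of `T`; the right unit law gives the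
absorption on the other side in `map_idem_action`. -/
theorem action_idem (h : IsWeakDistributiveLaw T S l) (A : T.Algebra) :
    action l A ≫ idem l A = action l A := by
  simp only [idem]
  rw [reassoc_of% unit_naturality T (action l A), ← h.mu_action]
  exact (reassoc_of% T.left_unit (S.obj A.A)) _

theorem map_idem_action (h : IsWeakDistributiveLaw T S l) (A : T.Algebra) :
    T.map (idem l A) ≫ action l A = action l A := by
  simp only [idem, Functor.map_comp, Category.assoc]
  rw [← h.mu_action]
  exact (reassoc_of% T.right_unit (S.obj A.A)) _

theorem idem_idem (h : IsWeakDistributiveLaw T S l) (A : T.Algebra) :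
    idem l A ≫ idem l A = idem l A := by
  conv_lhs => enter [1]; rw [idem]
  rw [Category.assoc, h.action_idem, idem]

theorem map_mu_action (h : IsWeakDistributiveLaw T S l) (A : T.Algebra) :
    T.map (S.μ.app A.A) ≫ action l A =
      l.app (S.obj A.A) ≫ S.map (action l A) ≫ S.μ.app A.A := by
  have h1 := h.mu_right A.A
  simp only [action, Functor.map_comp, Category.assoc]
  rw [reassoc_of% h1, mult_naturality S A.a]

theorem map_eta_action (h : IsWeakDistributiveLaw T S l) (A : T.Algebra) :
    T.map (S.η.app A.A) ≫ action l A = A.a ≫ S.η.app A.A := by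
  have h1 := h.eta_right A.A
  simp only [action]
  rw [reassoc_of% h1, unit_naturality S A.a]

theorem eta_idem (h : IsWeakDistributiveLaw T S l) (A : T.Algebra) :
    S.η.app A.A ≫ idem l A = S.η.app A.A := by
  simp only [idem]
  rw [reassoc_of% unit_naturality T (S.η.app A.A), h.map_eta_action]
  exact (reassoc_of% A.unit) _

theorem mu_idem (h : IsWeakDistributiveLaw T S l) (A : T.Algebra) :
    S.μ.app A.A ≫ idem l A =
      T.η.app (S.obj (S.obj A.A)) ≫ l.app (S.obj A.A) ≫ S.map (action l A) ≫ S.μ.app A.A := by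
  simp only [idem]
  rw [reassoc_of% unit_naturality T (S.μ.app A.A), h.map_mu_action]

/-- Expanding the outer idempotent by `mu_idem` exposes an inner action, which absorbs the inner
idempotent. Compatibility of the projection with multiplication rests on this. -/
theorem map_idem_mu_idem (h : IsWeakDistributiveLaw T S l) (A : T.Algebra) :
    S.map (idem l A) ≫ S.μ.app A.A ≫ idem l A = S.μ.app A.A ≫ idem l A := by
  rw [h.mu_idem, reassoc_of% unit_naturality T (S.map (idem l A)),
    reassoc_of% law_naturality l (idem l A), ← Functor.map_comp_assoc S.toFunctor,
    h.map_idem_action]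

/-! ### The weak lifting obtained by splitting idempotents -/

section Lifting

variable [IsIdempotentComplete C]

theorem exists_splitting (h : IsWeakDistributiveLaw T S l) (A : T.Algebra) :
    ∃ (Y : C) (i : Y ⟶ S.obj A.A) (p : S.obj A.A ⟶ Y), i ≫ p = 𝟙 Y ∧ p ≫ i = idem l A :=
  IsIdempotentComplete.idempotents_split _ _ (h.idem_idem A)

/-- The algebra structure `T Y ⟶ T S A ⟶ S A ⟶ Y` on a splitting `Y` of the idempotent on `S A`. -/
def splitAlgebra (h : IsWeakDistributiveLaw T S l) (A : T.Algebra) {Y : C} (i : Y ⟶ S.obj A.A)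
    (p : S.obj A.A ⟶ Y) (hip : i ≫ p = 𝟙 Y) (hpi : p ≫ i = idem l A) : T.Algebra where
  A := Y
  a := T.map i ≫ action l A ≫ p
  unit := by
    rw [← reassoc_of% unit_naturality T i, ← Category.assoc (T.η.app _), ← idem, ← hpi,
      Category.assoc, hip, Category.comp_id, hip]
  assoc := by
    simp only [Functor.map_comp, Category.assoc]
    -- The inner `p ≫ i` is the idempotent, which the next action absorbs.
    rw [← Functor.map_comp_assoc T.toFunctor p, hpi, reassoc_of% h.map_idem_action A,
      ← reassoc_of% h.mu_action A, reassoc_of% mult_naturality T i]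

/-- The lifting of `S` to `T`-algebras, on objects. -/
noncomputable def liftObj (h : IsWeakDistributiveLaw T S l) (A : T.Algebra) : T.Algebra :=
  h.splitAlgebra A _ _ (h.exists_splitting A).choose_spec.choose_spec.choose_spec.1
    (h.exists_splitting A).choose_spec.choose_spec.choose_spec.2

/-- The inclusion of the lifted algebra into `S A`. -/
noncomputable def inc (h : IsWeakDistributiveLaw T S l) (A : T.Algebra) :
    (h.liftObj A).A ⟶ S.obj A.A :=
  (h.exists_splitting A).choose_spec.choose

/-- The projection of `S A` onto the lifted algebra. -/
noncomputable def pr (h : IsWeakDistributiveLaw T S l) (A : T.Algebra) :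
    S.obj A.A ⟶ (h.liftObj A).A :=
  (h.exists_splitting A).choose_spec.choose_spec.choose

theorem inc_pr (h : IsWeakDistributiveLaw T S l) (A : T.Algebra) :
    h.inc A ≫ h.pr A = 𝟙 (h.liftObj A).A :=
  (h.exists_splitting A).choose_spec.choose_spec.choose_spec.1

theorem pr_inc (h : IsWeakDistributiveLaw T S l) (A : T.Algebra) :
    h.pr A ≫ h.inc A = idem l A :=
  (h.exists_splitting A).choose_spec.choose_spec.choose_spec.2

theorem inc_idem (h : IsWeakDistributiveLaw T S l) (A : T.Algebra) :
    h.inc A ≫ idem l A = h.inc A := by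
  rw [← h.pr_inc, ← Category.assoc, h.inc_pr, Category.id_comp]

theorem inc_cancel (h : IsWeakDistributiveLaw T S l) (A : T.Algebra) {X : C}
    {f g : X ⟶ (h.liftObj A).A} (w : f ≫ h.inc A = g ≫ h.inc A) : f = g := by
  have := congrArg (· ≫ h.pr A) w
  simpa only [Category.assoc, h.inc_pr, Category.comp_id] using this

theorem liftObj_a (h : IsWeakDistributiveLaw T S l) (A : T.Algebra) :
    (h.liftObj A).a = T.map (h.inc A) ≫ action l A ≫ h.pr A :=
  rfl

theorem str_inc (h : IsWeakDistributiveLaw T S l) (A : T.Algebra) :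
    (h.liftObj A).a ≫ h.inc A = T.map (h.inc A) ≫ action l A := by
  simp only [liftObj_a, Category.assoc]
  rw [h.pr_inc, h.action_idem]

theorem map_pr_str (h : IsWeakDistributiveLaw T S l) (A : T.Algebra) :
    T.map (h.pr A) ≫ (h.liftObj A).a = action l A ≫ h.pr A := by
  rw [liftObj_a, ← Functor.map_comp_assoc, h.pr_inc, reassoc_of% h.map_idem_action A]

/-- A morphism into a lifted algebra, from compatibility after inclusion into `S A`. -/
noncomputable def homToLift (h : IsWeakDistributiveLaw T S l) {B A : T.Algebra}
    (f : B.A ⟶ (h.liftObj A).A)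
    (w : T.map (f ≫ h.inc A) ≫ action l A = B.a ≫ f ≫ h.inc A) : B ⟶ h.liftObj A where
  f := f
  h := by
    apply h.inc_cancel
    rw [Category.assoc, Category.assoc, h.str_inc, ← Functor.map_comp_assoc, w]

theorem inc_map_pr_inc (h : IsWeakDistributiveLaw T S l) {A B : T.Algebra} (f : A ⟶ B) :
    (h.inc A ≫ S.map f.f ≫ h.pr B) ≫ h.inc B = h.inc A ≫ S.map f.f := by
  simp only [Category.assoc]
  rw [h.pr_inc, idem_naturality f, reassoc_of% h.inc_idem A]

/-- The lifting of `S` to `T`-algebras, on morphisms. -/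
noncomputable def liftMap (h : IsWeakDistributiveLaw T S l) {A B : T.Algebra} (f : A ⟶ B) :
    h.liftObj A ⟶ h.liftObj B :=
  h.homToLift (h.inc A ≫ S.map f.f ≫ h.pr B) (by
    rw [h.inc_map_pr_inc, Functor.map_comp, Category.assoc, action_naturality f,
      reassoc_of% h.str_inc A])

theorem liftMap_inc (h : IsWeakDistributiveLaw T S l) {A B : T.Algebra} (f : A ⟶ B) :
    (h.liftMap f).f ≫ h.inc B = h.inc A ≫ S.map f.f :=
  h.inc_map_pr_inc f

theorem map_pr_liftMap (h : IsWeakDistributiveLaw T S l) {A B : T.Algebra} (f : A ⟶ B) :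
    S.map f.f ≫ h.pr B = h.pr A ≫ (h.liftMap f).f := by
  apply h.inc_cancel
  rw [Category.assoc, Category.assoc, h.liftMap_inc, h.pr_inc, reassoc_of% h.pr_inc A,
    idem_naturality f]

theorem hom_ext_inc (h : IsWeakDistributiveLaw T S l) {B A : T.Algebra}
    {f g : B ⟶ h.liftObj A} (w : f.f ≫ h.inc A = g.f ≫ h.inc A) : f = g :=
  Monad.Algebra.Hom.ext (h.inc_cancel A w)

/-- The unit of the lifted monad. -/
noncomputable def liftUnit (h : IsWeakDistributiveLaw T S l) (A : T.Algebra) :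
    A ⟶ h.liftObj A :=
  h.homToLift (S.η.app A.A ≫ h.pr A) (by
    rw [Category.assoc, h.pr_inc, h.eta_idem, h.map_eta_action])

theorem liftUnit_inc (h : IsWeakDistributiveLaw T S l) (A : T.Algebra) :
    (h.liftUnit A).f ≫ h.inc A = S.η.app A.A := by
  change (S.η.app A.A ≫ h.pr A) ≫ h.inc A = _
  rw [Category.assoc, h.pr_inc, h.eta_idem]

/-- Equivariance of `μ^S ∘ S(inc)`; it therefore commutes with the idempotents and restricts to the
split parts, which yields the lifted multiplication. -/
theorem map_map_inc_mu_action (h : IsWeakDistributiveLaw T S l) (A : T.Algebra) :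
    T.map (S.map (h.inc A) ≫ S.μ.app A.A) ≫ action l A =
      action l (h.liftObj A) ≫ S.map (h.inc A) ≫ S.μ.app A.A := by
  rw [Functor.map_comp, Category.assoc, h.map_mu_action, reassoc_of% law_naturality l (h.inc A),
    ← Functor.map_comp_assoc S.toFunctor, ← h.str_inc, Functor.map_comp, action]
  simp only [Category.assoc]

theorem map_inc_mu_idem (h : IsWeakDistributiveLaw T S l) (A : T.Algebra) :
    (S.map (h.inc A) ≫ S.μ.app A.A) ≫ idem l A =
      idem l (h.liftObj A) ≫ S.map (h.inc A) ≫ S.μ.app A.A := by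
  rw [idem, ← Category.assoc, unit_naturality, Category.assoc, h.map_map_inc_mu_action, idem,
    Category.assoc]

theorem inc_map_inc_mu_pr_inc (h : IsWeakDistributiveLaw T S l) (A : T.Algebra) :
    (h.inc (h.liftObj A) ≫ (S.map (h.inc A) ≫ S.μ.app A.A) ≫ h.pr A) ≫ h.inc A =
      h.inc (h.liftObj A) ≫ S.map (h.inc A) ≫ S.μ.app A.A := by
  rw [Category.assoc, Category.assoc, h.pr_inc, h.map_inc_mu_idem, reassoc_of% h.inc_idem]

/-- The multiplication of the lifted monad. -/
noncomputable def liftMult (h : IsWeakDistributiveLaw T S l) (A : T.Algebra) :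
    h.liftObj (h.liftObj A) ⟶ h.liftObj A :=
  h.homToLift (h.inc (h.liftObj A) ≫ (S.map (h.inc A) ≫ S.μ.app A.A) ≫ h.pr A) (by
    rw [h.inc_map_inc_mu_pr_inc, Functor.map_comp, Category.assoc, h.map_map_inc_mu_action,
      reassoc_of% h.str_inc (h.liftObj A)])

theorem liftMult_inc (h : IsWeakDistributiveLaw T S l) (A : T.Algebra) :
    (h.liftMult A).f ≫ h.inc A =
      h.inc (h.liftObj A) ≫ S.map (h.inc A) ≫ S.μ.app A.A :=
  h.inc_map_inc_mu_pr_inc A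

theorem mu_pr (h : IsWeakDistributiveLaw T S l) (A : T.Algebra) :
    S.μ.app A.A ≫ h.pr A =
      S.map (h.pr A) ≫ h.pr (h.liftObj A) ≫ (h.liftMult A).f := by
  apply h.inc_cancel
  simp only [Category.assoc]
  rw [h.pr_inc, h.liftMult_inc, reassoc_of% h.pr_inc (h.liftObj A), ← h.map_inc_mu_idem,
    Category.assoc]
  -- The inner idempotent is inserted for free, then factored as projection followed by inclusion.
  refine (h.map_idem_mu_idem A).symm.trans ?_
  rw [← h.pr_inc, Functor.map_comp, Category.assoc]

theorem liftMap_id (h : IsWeakDistributiveLaw T S l) (A : T.Algebra) :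
    h.liftMap (𝟙 A) = 𝟙 (h.liftObj A) := by
  have e : S.map (𝟙 A.A) = 𝟙 (S.obj A.A) := S.map_id A.A
  apply h.hom_ext_inc
  rw [h.liftMap_inc, Monad.Algebra.id_f, Monad.Algebra.id_f, e, Category.comp_id, Category.id_comp]

theorem liftMap_comp (h : IsWeakDistributiveLaw T S l) {A B D : T.Algebra} (f : A ⟶ B)
    (g : B ⟶ D) : h.liftMap (f ≫ g) = h.liftMap f ≫ h.liftMap g := by
  apply h.hom_ext_inc
  simp only [h.liftMap_inc, Monad.Algebra.comp_f, Functor.map_comp, Category.assoc]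
  rw [reassoc_of% h.liftMap_inc f]

theorem liftUnit_naturality (h : IsWeakDistributiveLaw T S l) {A B : T.Algebra} (f : A ⟶ B) :
    f ≫ h.liftUnit B = h.liftUnit A ≫ h.liftMap f := by
  apply h.hom_ext_inc
  simp only [Monad.Algebra.comp_f, Category.assoc]
  rw [h.liftUnit_inc, h.liftMap_inc, reassoc_of% h.liftUnit_inc A, unit_naturality S f.f]

theorem liftMult_naturality (h : IsWeakDistributiveLaw T S l) {A B : T.Algebra} (f : A ⟶ B) :
    h.liftMap (h.liftMap f) ≫ h.liftMult B = h.liftMult A ≫ h.liftMap f := by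
  apply h.hom_ext_inc
  simp only [Monad.Algebra.comp_f, Category.assoc]
  rw [h.liftMult_inc, h.liftMap_inc, reassoc_of% h.liftMult_inc A,
    reassoc_of% h.liftMap_inc (h.liftMap f), ← mult_naturality S f.f,
    ← Functor.map_comp_assoc, ← Functor.map_comp_assoc, h.liftMap_inc]

theorem liftMult_assoc (h : IsWeakDistributiveLaw T S l) (A : T.Algebra) :
    h.liftMap (h.liftMult A) ≫ h.liftMult A = h.liftMult (h.liftObj A) ≫ h.liftMult A := by
  have e : S.map (S.μ.app A.A) ≫ S.μ.app A.A = S.μ.app (S.obj A.A) ≫ S.μ.app A.A := S.assoc A.A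
  apply h.hom_ext_inc
  simp only [Monad.Algebra.comp_f, Category.assoc]
  rw [h.liftMult_inc, reassoc_of% h.liftMap_inc (h.liftMult A), ← Functor.map_comp_assoc,
    h.liftMult_inc, reassoc_of% h.liftMult_inc (h.liftObj A),
    ← reassoc_of% mult_naturality S (h.inc A), ← e]
  simp only [Functor.map_comp, Category.assoc]

theorem liftMult_left_unit (h : IsWeakDistributiveLaw T S l) (A : T.Algebra) :
    h.liftUnit (h.liftObj A) ≫ h.liftMult A = 𝟙 (h.liftObj A) := by
  have e : S.η.app (S.obj A.A) ≫ S.μ.app A.A = 𝟙 (S.obj A.A) := S.left_unit A.A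
  apply h.hom_ext_inc
  simp only [Monad.Algebra.comp_f, Monad.Algebra.id_f, Category.assoc]
  rw [h.liftMult_inc, reassoc_of% h.liftUnit_inc (h.liftObj A),
    ← reassoc_of% unit_naturality S (h.inc A), e, Category.comp_id, Category.id_comp]

theorem liftMult_right_unit (h : IsWeakDistributiveLaw T S l) (A : T.Algebra) :
    h.liftMap (h.liftUnit A) ≫ h.liftMult A = 𝟙 (h.liftObj A) := by
  have e : S.map (S.η.app A.A) ≫ S.μ.app A.A = 𝟙 (S.obj A.A) := S.right_unit A.A
  apply h.hom_ext_inc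
  simp only [Monad.Algebra.comp_f, Monad.Algebra.id_f, Category.assoc]
  rw [h.liftMult_inc, reassoc_of% h.liftMap_inc (h.liftUnit A), ← Functor.map_comp_assoc,
    h.liftUnit_inc, e, Category.comp_id, Category.id_comp]

/-- The functor on `T`-algebras splitting the idempotents on the objects `S A`. -/
noncomputable def liftFunctor (h : IsWeakDistributiveLaw T S l) : T.Algebra ⥤ T.Algebra where
  obj := h.liftObj
  map := h.liftMap
  map_id := h.liftMap_id
  map_comp := h.liftMap_comp

/-- The lifted monad on `T`-algebras. -/
noncomputable def liftMonad (h : IsWeakDistributiveLaw T S l) : Monad T.Algebra where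
  toFunctor := h.liftFunctor
  η :=
    { app := h.liftUnit
      naturality _ _ f := h.liftUnit_naturality f }
  μ :=
    { app := h.liftMult
      naturality _ _ f := h.liftMult_naturality f }
  assoc := h.liftMult_assoc
  left_unit := h.liftMult_left_unit
  right_unit := h.liftMult_right_unit

/-- The weak lifting of `S` on `T` obtained by splitting idempotents. -/
noncomputable def weakLifting (h : IsWeakDistributiveLaw T S l) : WeakLifting T S where
  lift := h.liftMonad
  π :=
    { app := h.pr
      naturality _ _ f := h.map_pr_liftMap f }
  ι :=
    { app := h.inc
      naturality _ _ f := h.liftMap_inc f }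
  ι_π := by
    ext A
    exact h.inc_pr A
  ι_mu := h.liftMult_inc
  π_mu := h.mu_pr
  ι_eta := h.liftUnit_inc
  π_eta _ := rfl

/-- On the free algebra the action absorbs the idempotent, leaving `Sμ^T ∘ λT`; naturality of the
law and the right unit law of `T` then cancel `η^T` against `μ^T`. -/
theorem weakLifting_toLaw (h : IsWeakDistributiveLaw T S l) : h.weakLifting.toLaw = l := by
  ext X
  have e : T.map (h.pr (T.free.obj X)) ≫ (h.liftObj (T.free.obj X)).a ≫ h.inc (T.free.obj X) =
      l.app (T.obj X) ≫ S.map (T.μ.app X) := by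
    rw [reassoc_of% h.map_pr_str (T.free.obj X), h.pr_inc, h.action_idem]
    rfl
  have r : S.map (T.map (T.η.app X)) ≫ S.map (T.μ.app X) = 𝟙 (S.obj (T.obj X)) := by
    rw [← Functor.map_comp, T.right_unit X]
    exact S.map_id _
  refine (congrArg (T.map (S.map (T.η.app X)) ≫ ·) e).trans ?_
  change T.map (S.map (T.η.app X)) ≫ l.app (T.obj X) ≫ S.map (T.μ.app X) = _
  rw [reassoc_of% law_naturality l (T.η.app X), r]
  exact Category.comp_id _

end Lifting

end IsWeakDistributiveLaw

/-! ### Arbitrary weak liftings and their composite monads -/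

namespace WeakLifting

variable {C : Type u} [Category.{v} C] {T S : Monad C} (W : WeakLifting T S)

/-- `toLaw` sees the lifting only on free algebras. The structure map of `A`, a morphism of algebras
from the free one, extends the formula to all algebras, since `η^T` is a section of it in the base
category. -/
theorem map_proj_lift_incl (A : T.Algebra) :
    T.map (W.proj A) ≫ (W.lift.obj A).a ≫ W.incl A = W.toLaw.app A.A ≫ S.map A.a := by
  let e : T.free.obj A.A ⟶ A := ⟨A.a, A.assoc.symm⟩
  have h1 : S.map A.a ≫ W.proj A = W.proj (T.free.obj A.A) ≫ (W.lift.map e).f :=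
    W.proj_naturality e
  have h2 : (W.lift.map e).f ≫ W.incl A = W.incl (T.free.obj A.A) ≫ S.map A.a :=
    W.incl_naturality e
  have h3 := (W.lift.map e).h
  have h4 : T.map (S.map (T.η.app A.A)) ≫ T.map (S.map A.a) = 𝟙 (T.obj (S.obj A.A)) := by
    rw [← Functor.map_comp, ← Functor.map_comp, A.unit]
    exact (congrArg T.map (S.map_id _)).trans (T.map_id _)
  have key : ∀ {P Q : C} (p : S.obj (T.obj A.A) ⟶ P) (b : T.obj P ⟶ P)
      (i : P ⟶ S.obj (T.obj A.A)) (p' : S.obj A.A ⟶ Q) (b' : T.obj Q ⟶ Q) (i' : Q ⟶ S.obj A.A)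
      (g : P ⟶ Q), S.map A.a ≫ p' = p ≫ g → g ≫ i' = i ≫ S.map A.a → T.map g ≫ b' = b ≫ g →
      T.map p' ≫ b' ≫ i' =
        (T.map (S.map (T.η.app A.A)) ≫ T.map p ≫ b ≫ i) ≫ S.map A.a := by
    intro P Q p b i p' b' i' g h1 h2 h3
    simp only [Category.assoc]
    rw [← h2, ← reassoc_of% h3, ← Functor.map_comp_assoc T.toFunctor p, ← h1,
      Functor.map_comp_assoc, reassoc_of% h4]
  exact key _ _ _ _ _ _ _ h1 h2 h3

theorem incl_proj (A : T.Algebra) : W.incl A ≫ W.proj A = 𝟙 (W.lift.obj A).A :=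
  congrArg (fun t => t.app A) W.ι_π

theorem lift_a_incl (A : T.Algebra) :
    (W.lift.obj A).a ≫ W.incl A = T.map (W.incl A) ≫ W.toLaw.app A.A ≫ S.map A.a := by
  rw [← W.map_proj_lift_incl, ← Functor.map_comp_assoc, W.incl_proj, CategoryTheory.Functor.map_id,
    Category.id_comp]

theorem map_proj_lift_a (A : T.Algebra) :
    T.map (W.proj A) ≫ (W.lift.obj A).a = W.toLaw.app A.A ≫ S.map A.a ≫ W.proj A := by
  rw [← reassoc_of% W.map_proj_lift_incl A, W.incl_proj, Category.comp_id]

/-- The structure map of the lifted algebra on `S (T X)`, as a morphism of algebras. -/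
def counitHom (X : C) : T.free.obj (W.compositeMonad.obj X) ⟶ W.lift.obj (T.free.obj X) :=
  T.adj.counit.app (W.lift.obj (T.free.obj X))

theorem counitHom_f (X : C) : (W.counitHom X).f = (W.lift.obj (T.free.obj X)).a := by
  simp [counitHom]
  rfl

theorem compositeMonad_mu (X : C) :
    W.compositeMonad.μ.app X =
      (W.lift.map (W.counitHom X)).f ≫ (W.lift.μ.app (T.free.obj X)).f := by
  simp [compositeMonad, counitHom]
  rfl

theorem compositeMonad_eta (X : C) :
    W.compositeMonad.η.app X = T.η.app X ≫ (W.lift.η.app (T.free.obj X)).f := by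
  simp [compositeMonad]
  rfl

/-- The multiplication `S T S T X ⟶ S T X` induced by the law of a weak lifting. -/
def preMult (l : S.toFunctor ⋙ T.toFunctor ⟶ T.toFunctor ⋙ S.toFunctor) (X : C) :
    S.obj (T.obj (S.obj (T.obj X))) ⟶ S.obj (T.obj X) :=
  S.map (l.app (T.obj X) ≫ S.map (T.μ.app X)) ≫ S.μ.app (T.obj X)

/-- The composite multiplication is the lifted one preceded by the lifted counit. `ι_mu` handles the
former; `lift_a_incl` turns the algebra structure in the latter into the law. `piStar_mu` is the
counterpart for `π`. -/
theorem mu_iotaStar (X : C) :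
    W.compositeMonad.μ.app X ≫ W.iotaStar.app X =
      W.iotaStar.app (W.compositeMonad.obj X) ≫ S.map (T.map (W.iotaStar.app X)) ≫
        preMult W.toLaw X := by
  have h1 : (W.lift.μ.app (T.free.obj X)).f ≫ W.incl (T.free.obj X) =
      W.incl (W.lift.obj (T.free.obj X)) ≫ S.map (W.incl (T.free.obj X)) ≫ S.μ.app (T.obj X) :=
    W.ι_mu (T.free.obj X)
  have h2 := W.incl_naturality (W.counitHom X)
  have h3 := W.lift_a_incl (T.free.obj X)
  rw [counitHom_f] at h2
  have key : ∀ {K M N : C} (i : K ⟶ S.obj (T.obj X)) (a : T.obj K ⟶ K) (i₁ : N ⟶ S.obj K)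
      (i₂ : M ⟶ S.obj (T.obj K)) (g : M ⟶ N) (m : N ⟶ K),
      m ≫ i = i₁ ≫ S.map i ≫ S.μ.app (T.obj X) → g ≫ i₁ = i₂ ≫ S.map a →
      a ≫ i = T.map i ≫ W.toLaw.app (T.obj X) ≫ S.map (T.μ.app X) →
      (g ≫ m) ≫ i = i₂ ≫ S.map (T.map i) ≫ preMult W.toLaw X := by
    intro K M N i a i₁ i₂ g m h1 h2 h3
    rw [Category.assoc, h1, reassoc_of% h2, ← Functor.map_comp_assoc, h3, Functor.map_comp_assoc,
      preMult]
  rw [compositeMonad_mu]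
  exact key _ _ _ _ _ _ h1 h2 h3

theorem piStar_mu (X : C) :
    S.map (T.map (W.piStar.app X)) ≫ W.piStar.app (W.compositeMonad.obj X) ≫
        W.compositeMonad.μ.app X =
      preMult W.toLaw X ≫ W.piStar.app X := by
  have h1 : S.μ.app (T.obj X) ≫ W.proj (T.free.obj X) = S.map (W.proj (T.free.obj X)) ≫
      W.proj (W.lift.obj (T.free.obj X)) ≫ (W.lift.μ.app (T.free.obj X)).f :=
    W.π_mu (T.free.obj X)
  have h2 := W.proj_naturality (W.counitHom X)
  have h3 := W.map_proj_lift_a (T.free.obj X)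
  rw [counitHom_f] at h2
  have key : ∀ {K M N : C} (p : S.obj (T.obj X) ⟶ K) (a : T.obj K ⟶ K) (p₁ : S.obj K ⟶ N)
      (p₂ : S.obj (T.obj K) ⟶ M) (g : M ⟶ N) (m : N ⟶ K),
      S.μ.app (T.obj X) ≫ p = S.map p ≫ p₁ ≫ m → S.map a ≫ p₁ = p₂ ≫ g →
      T.map p ≫ a = W.toLaw.app (T.obj X) ≫ S.map (T.μ.app X) ≫ p →
      S.map (T.map p) ≫ p₂ ≫ g ≫ m = preMult W.toLaw X ≫ p := by
    intro K M N p a p₁ p₂ g m h1 h2 h3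
    rw [← reassoc_of% h2, ← Functor.map_comp_assoc, h3, preMult, Category.assoc, h1]
    simp only [Functor.map_comp, Category.assoc]
  rw [compositeMonad_mu]
  exact key _ _ _ _ _ _ h1 h2 h3

end WeakLifting

/-! ### Transfer of the composite law -/

section Composite

variable {C : Type u} [Category.{v} C] {T S : Monad C} {G : C ⥤ C}
  {lam : S.toFunctor ⋙ T.toFunctor ⟶ T.toFunctor ⋙ S.toFunctor}
  {σ : G ⋙ T.toFunctor ⟶ T.toFunctor ⋙ G} {τ : G ⋙ S.toFunctor ⟶ S.toFunctor ⋙ G}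

/-- The composite `S T G X ⟶ S G T X ⟶ G S T X` of `σ` and `τ`. -/
def compositeTransfer (σ : G ⋙ T.toFunctor ⟶ T.toFunctor ⋙ G)
    (τ : G ⋙ S.toFunctor ⟶ S.toFunctor ⋙ G) (X : C) :
    S.obj (T.obj (G.obj X)) ⟶ G.obj (S.obj (T.obj X)) :=
  S.map (σ.app X) ≫ τ.app (T.obj X)

theorem compositeTransfer_naturality {X Y : C} (f : X ⟶ Y) :
    S.map (T.map (G.map f)) ≫ compositeTransfer σ τ Y =
      compositeTransfer σ τ X ≫ G.map (S.map (T.map f)) := by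
  have h1 : T.map (G.map f) ≫ σ.app Y = σ.app X ≫ G.map (T.map f) := σ.naturality f
  have h2 : S.map (G.map (T.map f)) ≫ τ.app (T.obj Y) = τ.app (T.obj X) ≫ G.map (S.map (T.map f)) :=
    τ.naturality (T.map f)
  simp only [compositeTransfer, Category.assoc]
  rw [← Functor.map_comp_assoc, h1, Functor.map_comp_assoc, h2]

/-- The laws `σ` and `τ` move `G` past the two multiplications, and Yang–Baxter moves it past the
exchange of `T` and `S` inside `preMult`. -/
theorem preMult_compositeTransfer (hσ : IsWeakDistributiveLawOver T G σ)
    (hτ : IsWeakDistributiveLawOver S G τ) (hYB : YangBaxter lam σ τ) (X : C) :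
    WeakLifting.preMult lam (G.obj X) ≫ compositeTransfer σ τ X =
      S.map (T.map (compositeTransfer σ τ X)) ≫ compositeTransfer σ τ (S.obj (T.obj X)) ≫
        G.map (WeakLifting.preMult lam X) := by
  have nσ : lam.app (T.obj (G.obj X)) ≫ S.map (T.map (σ.app X)) =
      T.map (S.map (σ.app X)) ≫ lam.app (G.obj (T.obj X)) := (lam.naturality (σ.app X)).symm
  have nS : S.μ.app (T.obj (G.obj X)) ≫ S.map (σ.app X) =
      S.map (S.map (σ.app X)) ≫ S.μ.app (G.obj (T.obj X)) := (S.μ.naturality (σ.app X)).symm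
  have nτ : ∀ {Y Z : C} (f : Y ⟶ Z), S.map (G.map f) ≫ τ.app Z = τ.app Y ≫ G.map (S.map f) :=
    fun f => τ.naturality f
  have yb := hYB (T.obj X)
  calc
    _ = S.map (lam.app (T.obj (G.obj X))) ≫ S.map (S.map (T.μ.app (G.obj X) ≫ σ.app X)) ≫
          S.μ.app (G.obj (T.obj X)) ≫ τ.app (T.obj X) := by
      simp only [WeakLifting.preMult, compositeTransfer, Functor.map_comp, Category.assoc]
      rw [reassoc_of% nS]
    _ = S.map (T.map (S.map (σ.app X))) ≫
          S.map (lam.app (G.obj (T.obj X)) ≫ S.map (σ.app (T.obj X)) ≫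
            S.map (G.map (T.μ.app X)) ≫ τ.app (T.obj X)) ≫ τ.app (S.obj (T.obj X)) ≫
          G.map (S.μ.app (T.obj X)) := by
      rw [hσ.mu, hτ.mu]
      simp only [Functor.map_comp, Category.assoc]
      rw [← Functor.map_comp_assoc S.toFunctor (lam.app _), nσ, Functor.map_comp_assoc]
    _ = S.map (T.map (S.map (σ.app X)) ≫ T.map (τ.app (T.obj X)) ≫ σ.app (S.obj (T.obj X))) ≫
          S.map (G.map (lam.app (T.obj X) ≫ S.map (T.μ.app X))) ≫ τ.app (S.obj (T.obj X)) ≫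
          G.map (S.μ.app (T.obj X)) := by
      -- Naturality of `τ` pushes `μ^T` to the end, exposing one side of Yang–Baxter at `T X`.
      rw [nτ, reassoc_of% yb]
      simp only [Functor.map_comp, Category.assoc]
    _ = _ := by
      rw [reassoc_of% nτ]
      simp only [WeakLifting.preMult, compositeTransfer, Functor.map_comp, Category.assoc]

theorem compositeTransfer_eta (hσ : IsDistributiveLawOver T G σ)
    (hτ : IsDistributiveLawOver S G τ) (X : C) :
    T.η.app (G.obj X) ≫ S.η.app (T.obj (G.obj X)) ≫ compositeTransfer σ τ X =
      G.map (T.η.app X ≫ S.η.app (T.obj X)) := by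
  have nη : S.η.app (T.obj (G.obj X)) ≫ S.map (σ.app X) = σ.app X ≫ S.η.app (G.obj (T.obj X)) :=
    (S.η.naturality (σ.app X)).symm
  rw [compositeTransfer, reassoc_of% nη, hτ.eta (T.obj X), reassoc_of% hσ.eta X, ← G.map_comp]

/-- A law of a monad `K` over `G` obtained by transferring `compositeTransfer σ τ` along maps
`i : K X ⟶ S T X` and `p : S T X ⟶ K X` is compatible with the multiplication of `K` as soon as
`i` and `p` are. -/
theorem mu_of_transfer (K : Monad C) (i : ∀ X, K.obj X ⟶ S.obj (T.obj X))
    (p : ∀ X, S.obj (T.obj X) ⟶ K.obj X)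
    (hi : ∀ {X Y : C} (f : X ⟶ Y), K.map f ≫ i Y = i X ≫ S.map (T.map f))
    (hiμ : ∀ X, K.μ.app X ≫ i X =
      i (K.obj X) ≫ S.map (T.map (i X)) ≫ WeakLifting.preMult lam X)
    (hpμ : ∀ X, S.map (T.map (p X)) ≫ p (K.obj X) ≫ K.μ.app X =
      WeakLifting.preMult lam X ≫ p X)
    (hσ : IsWeakDistributiveLawOver T G σ)
    (hτ : IsWeakDistributiveLawOver S G τ) (hYB : YangBaxter lam σ τ) (X : C) :
    K.μ.app (G.obj X) ≫ i (G.obj X) ≫ compositeTransfer σ τ X ≫ G.map (p X) =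
      K.map (i (G.obj X) ≫ compositeTransfer σ τ X ≫ G.map (p X)) ≫
        (i (G.obj (K.obj X)) ≫ compositeTransfer σ τ (K.obj X) ≫ G.map (p (K.obj X))) ≫
          G.map (K.μ.app X) := by
  have h1 := hiμ (G.obj X)
  have h3 := preMult_compositeTransfer hσ hτ hYB X
  simp only [Category.assoc]
  -- Naturality carries `i` to the front and the intermediate `p` to the back, so the idempotent `p
  -- ≫ i` never has to be compared with the transfer map.
  rw [reassoc_of% hi, reassoc_of% h1, reassoc_of% h3, ← G.map_comp, ← hpμ]
  simp only [Functor.map_comp, Category.assoc]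
  rw [reassoc_of% compositeTransfer_naturality (σ := σ) (τ := τ) (p X)]

theorem WeakLifting.compositeLaw_app (W : WeakLifting T S) (X : C) :
    (W.compositeLaw σ τ).app X =
      W.iotaStar.app (G.obj X) ≫ compositeTransfer σ τ X ≫ G.map (W.piStar.app X) := by
  simp only [compositeTransfer, Category.assoc]
  rfl

theorem WeakLifting.compositeLaw_isWeakDistributiveLawOver (W : WeakLifting T S)
    (hσ : IsWeakDistributiveLawOver T G σ) (hτ : IsWeakDistributiveLawOver S G τ)
    (hYB : YangBaxter W.toLaw σ τ) :
    IsWeakDistributiveLawOver W.compositeMonad G (W.compositeLaw σ τ) where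
  mu X := by
    simp only [compositeLaw_app]
    exact mu_of_transfer W.compositeMonad (fun X => W.iotaStar.app X) (fun X => W.piStar.app X)
      (fun f => W.iotaStar.naturality f) W.mu_iotaStar W.piStar_mu hσ hτ hYB X

theorem WeakLifting.compositeLaw_isDistributiveLawOver (W : WeakLifting T S)
    (hσ : IsDistributiveLawOver T G σ) (hτ : IsDistributiveLawOver S G τ)
    (hYB : YangBaxter W.toLaw σ τ) :
    IsDistributiveLawOver W.compositeMonad G (W.compositeLaw σ τ) where
  toIsWeakDistributiveLawOver := W.compositeLaw_isWeakDistributiveLawOver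
    hσ.toIsWeakDistributiveLawOver hτ.toIsWeakDistributiveLawOver hYB
  eta X := by
    have h1 : (W.lift.η.app (T.free.obj (G.obj X))).f ≫ W.incl (T.free.obj (G.obj X)) =
        S.η.app (T.obj (G.obj X)) := W.ι_eta (T.free.obj (G.obj X))
    have h2 : S.η.app (T.obj X) ≫ W.proj (T.free.obj X) = (W.lift.η.app (T.free.obj X)).f :=
      W.π_eta (T.free.obj X)
    have key : ∀ {K K' : C} (e : T.obj (G.obj X) ⟶ K) (i : K ⟶ S.obj (T.obj (G.obj X)))
        (p : S.obj (T.obj X) ⟶ K') (e' : T.obj X ⟶ K'), e ≫ i = S.η.app (T.obj (G.obj X)) →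
        S.η.app (T.obj X) ≫ p = e' →
        (T.η.app (G.obj X) ≫ e) ≫ i ≫ compositeTransfer σ τ X ≫ G.map p =
          G.map (T.η.app X ≫ e') := by
      intro K K' e i p e' h1 h2
      rw [Category.assoc, reassoc_of% h1, reassoc_of% compositeTransfer_eta hσ hτ X, ← G.map_comp,
        Category.assoc, h2]
    rw [compositeMonad_eta, compositeMonad_eta, compositeLaw_app]
    exact key _ _ _ _ h1 h2

end Composite

theorem theorem1 {C : Type u} [Category.{v} C] [IsIdempotentComplete C]
    (T S : Monad C) (G : C ⥤ C)
    (lam : S.toFunctor ⋙ T.toFunctor ⟶ T.toFunctor ⋙ S.toFunctor)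
    (σ : G ⋙ T.toFunctor ⟶ T.toFunctor ⋙ G)
    (τ : G ⋙ S.toFunctor ⟶ S.toFunctor ⋙ G)
    (hlam : IsWeakDistributiveLaw T S lam)
    (hσ : IsWeakDistributiveLawOver T G σ)
    (hτ : IsWeakDistributiveLawOver S G τ)
    (hYB : YangBaxter lam σ τ) :
    (∃ W : WeakLifting T S, W.toLaw = lam) ∧
    ∀ W : WeakLifting T S, W.toLaw = lam →
      IsWeakDistributiveLawOver W.compositeMonad G (W.compositeLaw σ τ) ∧
      (IsDistributiveLawOver T G σ → IsDistributiveLawOver S G τ →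
        IsDistributiveLawOver W.compositeMonad G (W.compositeLaw σ τ)) := by
  refine ⟨⟨hlam.weakLifting, hlam.weakLifting_toLaw⟩, ?_⟩
  rintro W rfl
  exact ⟨W.compositeLaw_isWeakDistributiveLawOver hσ hτ hYB,
    fun hσ' hτ' => W.compositeLaw_isDistributiveLawOver hσ' hτ' hYB⟩
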